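/- Let $A\in\mathbb{R}^{n\times n}$ be symmetric, let $f$ be a real-valued function (defined on the spectrum of $A$), let $f(A)$ be the corresponding matrix function, and suppose that $f(A)\neq 0$. Let $\mathcal{G}(A)$ be the graph on $\{1,\dots,n\}$ in which $i\ne j$ are adjacent iff $[A]_{ij}\neq 0$, and let $C_1,\dots,C_m$ be the color classes of a distance-$d$ coloring of $\mathcal{G}(A)$, i.e. a partition of $\{1,\dots,n\}$ such that two distinct indices at geodesic distance at most $d$ never lie in the same class. Let $N_1,\dots,N_m$ be positive integers. For $\ell=1,\dots,m$ and $s=1,\dots,N_\ell$ let $w_\ell^{(s)}=\sum_{i\in C_\ell}X_{\ell,s,i}\,e_i$, where all the $X_{\ell,s,i}$ are independent random variables with values $\pm1$ taken with probability $\tfrac12$ each, and let $$T:=\sum_{\ell=1}^m\frac1{N_\ell}\sum_{s=1}^{N_\ell}(w_\ell^{(s)})^T f(A)\,w_\ell^{(s)}$$ be the stochastic probing estimator of $\operatorname{tr} f(A)$. Write $[M]_{C}$ for the submatrix of $M$ with row and column indices in $C$, $\operatorname{Off}(B)$ for the off-diagonal part of $B$, $\|\cdot\|_F$ and $\|\cdot\|_2$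 for the Frobenius and the spectral norm, and put $$\eta_1:=\sum_{\ell=1}^m\frac1{N_\ell}\|\operatorname{Off}([f(A)]_{C_\ell})\|_F^2,\qquad \eta_2:=\max_{\ell=1,\dots,m}\frac1{N_\ell}\|\operatorname{Off}([f(A)]_{C_\ell})\|_2 .$$ Then $\eta_1=\frac12\sum_{\ell=1}^m V_\ell/N_\ell$, where $V_\ell$ is the variance of $(w_\ell^{(s)})^T f(A)\,w_\ell^{(s)}$ (for any $s$), and for every $\varepsilon>0$ $$\mathbb{P}\bigl(|\operatorname{tr} f(A)-T|\ge\varepsilon\bigr)\le 2\exp\Bigl(-\frac{\varepsilon^2}{8\eta_1+8\varepsilon\eta_2}\Bigr),$$ where the right-hand side is read as $0$ if $\eta_1=\eta_2=0$. In particular, if $0<\delta\le1$ and $\eta_1+\varepsilon\eta_2\le\dfrac{\varepsilon^2}{8\log(2/\delta)}$, then $\mathbb{P}\bigl(|\operatorname{tr} f(A)-T|\ge\varepsilon\bigr)\le\delta$. -/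

import Mathlib

open MeasureTheory ProbabilityTheory
open scoped ENNReal Matrix

namespace StochasticProbing

/-- The undirected graph `𝒢(A)` of a symmetric matrix `A`: distinct `i`, `j` are adjacent iff
`A i j ≠ 0`. -/
def matrixGraph {n : ℕ} (A : Matrix (Fin n) (Fin n) ℝ) (hA : A.IsSymm) : SimpleGraph (Fin n) where
  Adj i j := i ≠ j ∧ A i j ≠ 0
  symm := ⟨fun i j h => ⟨h.1.symm, by rw [hA.apply i j]; exact h.2⟩⟩
  loopless := ⟨fun _ h => h.1 rfl⟩

/-- `col : V → {1, …, m}` is a distance-`d` coloring of `G`: distinct vertices at geodesic distance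
at most `d` get different colors. The distance is the extended one, so that vertices in different
connected components are at distance `⊤`. -/
def IsDistanceColoring {V : Type*} {m : ℕ} (G : SimpleGraph V) (d : ℕ) (col : V → Fin m) : Prop :=
  ∀ i j : V, i ≠ j → G.edist i j ≤ (d : ℕ∞) → col i ≠ col j

/-- The color class `C_ℓ = {i : col i = ℓ}`, as a type. -/
abbrev ColorClass {n m : ℕ} (col : Fin n → Fin m) (ℓ : Fin m) : Type := {i : Fin n // col i = ℓ}

/-- The submatrix `[M]_{C_ℓ}` of the rows and columns with index in `C_ℓ`. -/
def colorBlock {n m : ℕ} (M : Matrix (Fin n) (Fin n) ℝ) (col : Fin n → Fin m) (ℓ : Fin m) :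
    Matrix (ColorClass col ℓ) (ColorClass col ℓ) ℝ :=
  M.submatrix Subtype.val Subtype.val

/-- The off-diagonal part `Off(B)` of a square matrix. -/
def offDiag {ι : Type*} [DecidableEq ι] (B : Matrix ι ι ℝ) : Matrix ι ι ℝ :=
  B - Matrix.diagonal B.diag

/-- The Frobenius norm `‖B‖_F`. -/
noncomputable def frobNorm {ι : Type*} [Fintype ι] (B : Matrix ι ι ℝ) : ℝ :=
  letI : NormedAddCommGroup (Matrix ι ι ℝ) := Matrix.frobeniusNormedAddCommGroup
  ‖B‖

/-- The spectral norm `‖B‖₂`, the operator norm for the Euclidean vector norm. -/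
noncomputable def specNorm {ι : Type*} [Fintype ι] [DecidableEq ι] (B : Matrix ι ι ℝ) : ℝ :=
  ‖Matrix.toEuclideanCLM (n := ι) (𝕜 := ℝ) B‖

/-- The law of a Rademacher variable: the values `1` and `-1`, each with probability `1/2`. -/
noncomputable def rademacher : Measure ℝ :=
  (2⁻¹ : ℝ≥0∞) • (Measure.dirac (1 : ℝ) + Measure.dirac (-1 : ℝ))

/-- The random variables `X i` are i.i.d. Rademacher variables. -/
structure IsRademacherFamily {ι Ω : Type*} [MeasurableSpace Ω] (X : ι → Ω → ℝ) (μ : Measure Ω) :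
    Prop where
  hasLaw : ∀ i, HasLaw (X i) rademacher μ
  indep : iIndepFun X μ

/-- The index set of the random signs that are drawn: the color `ℓ`, the number `s` of the sample
for that color, and the index `i ∈ C_ℓ`. -/
abbrev SignIndex {n m : ℕ} (col : Fin n → Fin m) (N : Fin m → ℕ) : Type :=
  Σ ℓ : Fin m, Fin (N ℓ) × ColorClass col ℓ

/-- The probing vector `w_ℓ^(s) = ∑_{i ∈ C_ℓ} x_{ℓ,s,i} e_i`. -/
def probingVector {n m : ℕ} (col : Fin n → Fin m) (N : Fin m → ℕ) (x : SignIndex col N → ℝ)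
    (ℓ : Fin m) (s : Fin (N ℓ)) : Fin n → ℝ :=
  ∑ i : ColorClass col ℓ, x ⟨ℓ, s, i⟩ • Pi.single (i : Fin n) (1 : ℝ)

/-- The quadratic form `(w_ℓ^(s))ᵀ M w_ℓ^(s)`. -/
def probingForm {n m : ℕ} (M : Matrix (Fin n) (Fin n) ℝ) (col : Fin n → Fin m) (N : Fin m → ℕ)
    (x : SignIndex col N → ℝ) (ℓ : Fin m) (s : Fin (N ℓ)) : ℝ :=
  probingVector col N x ℓ s ⬝ᵥ M *ᵥ probingVector col N x ℓ s

/-- The stochastic probing estimator `∑_ℓ (1 / N_ℓ) ∑_s (w_ℓ^(s))ᵀ M w_ℓ^(s)` of `tr M`. -/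
noncomputable def probingEstimator {n m : ℕ} (M : Matrix (Fin n) (Fin n) ℝ) (col : Fin n → Fin m)
    (N : Fin m → ℕ) (x : SignIndex col N → ℝ) : ℝ :=
  ∑ ℓ : Fin m, (1 / (N ℓ : ℝ)) * ∑ s : Fin (N ℓ), probingForm M col N x ℓ s

/-- `η₁ = ∑_ℓ ‖Off([M]_{C_ℓ})‖_F² / N_ℓ`. -/
noncomputable def etaOne {n m : ℕ} (M : Matrix (Fin n) (Fin n) ℝ) (col : Fin n → Fin m)
    (N : Fin m → ℕ) : ℝ :=
  ∑ ℓ : Fin m, (1 / (N ℓ : ℝ)) * frobNorm (offDiag (colorBlock M col ℓ)) ^ 2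

/-- `η₂ = max_ℓ ‖Off([M]_{C_ℓ})‖₂ / N_ℓ`, a maximum over the finitely many colors. -/
noncomputable def etaTwo {n m : ℕ} (M : Matrix (Fin n) (Fin n) ℝ) (col : Fin n → Fin m)
    (N : Fin m → ℕ) : ℝ :=
  ⨆ ℓ : Fin m, (1 / (N ℓ : ℝ)) * specNorm (offDiag (colorBlock M col ℓ))

end StochasticProbing

/-! Signs satisfy $x_i^2=1$, so the diagonal of each color block contributes its trace exactly and
the error of the estimator is, almost surely, $-x^TEx$ for one matrix $E$ (`errorMatrix`), indexed
by all the signs. It is symmetric, has zero diagonal, satisfies $\|E\|_F^2=\eta_1$, and its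
quadratic form is at most $\eta_2\|x\|^2$ in absolute value. Everything reduces to a Bernstein
inequality for a Rademacher chaos $x^TBx$ with zero diagonal.

For that inequality the signs are first replaced by standard Gaussians. With zero diagonal the form
is affine in each coordinate, and $\cosh b\le e^{b^2/2}$ says that a Gaussian coordinate only
increases the exponential moment (`lintegral_exp_chaos_le_gaussian`). The Gaussian law is rotation
invariant, so diagonalizing $B$ splits the moment into factors
$(1-2\lambda_i)^{-1/2}\le\exp(\lambda_i+2\lambda_i^2/(1-2\kappa))$ for any
$\kappa\ge\max_i\lambda_i$ with $2\kappa<1$. Since $\sum_i\lambda_i=\operatorname{tr}B=0$, only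
$\|B\|_F^2$ survives (`lintegral_exp_gaussian_chaos_le`). Markov's inequality for $e^{rx^TBx}$ with
a suitable $r$, applied to $B$ and $-B$, gives the tail bound.

The variance identity is a separate fourth-moment computation (`IsRademacherFamily.variance_chaos`).
-/

namespace StochasticProbing

/-! ### Exponential moments: from Rademacher to Gaussian chaos -/

section GaussianComparison

variable {ι : Type*} [Fintype ι] [DecidableEq ι]

/-- A product measure with factors `ρ` may be replaced by the one with factors `γ` in an upper bound
when this is possible in every single coordinate. -/
lemma lintegral_pi_le_of_update_le (ρ γ : Measure ℝ) [SigmaFinite ρ] [SigmaFinite γ]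
    {f : (ι → ℝ) → ℝ≥0∞} (hf : Measurable f)
    (h : ∀ i x, ∫⁻ t, f (Function.update x i t) ∂ρ ≤ ∫⁻ t, f (Function.update x i t) ∂γ) :
    ∫⁻ x, f x ∂Measure.pi (fun _ => ρ) ≤ ∫⁻ x, f x ∂Measure.pi (fun _ => γ) := by
  have key : ∀ s : Finset ι, lmarginal (fun _ => ρ) s f ≤ lmarginal (fun _ => γ) s f := by
    intro s
    induction s using Finset.induction_on with
    | empty => simp
    | insert i s hi ih =>
      intro x
      -- The mixed family has `ρ` at `i` and `γ` elsewhere, hence agrees with `γ` on `s`. It allows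
      -- the `i`-integral to be moved from outermost, where the induction hypothesis applies, to
      -- innermost, where `h` applies.
      let κ : ι → Measure ℝ := Function.update (fun _ => γ) i ρ
      have : ∀ j, SigmaFinite (κ j) := by
        intro j
        by_cases hj : j = i
        · subst hj; simpa [κ]
        · simpa [κ, hj]
      have hκ : ∀ g, lmarginal κ s g = lmarginal (fun _ => γ) s g := by
        intro g
        have : (fun j : s => κ j) = fun _ => γ := by
          funext j
          have : (j : ι) ≠ i := fun e => hi (e ▸ j.2)
          simp [κ, this]
        funext y
        simp only [lmarginal]
        rw [this]
      rw [lmarginal_insert f hf hi]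
      calc ∫⁻ t, lmarginal (fun _ => ρ) s f (Function.update x i t) ∂ρ
          ≤ ∫⁻ t, lmarginal κ s f (Function.update x i t) ∂κ i := by
            rw [hκ]
            simp only [κ, Function.update_self]
            exact lintegral_mono fun t => ih _
        _ = lmarginal κ s (fun x => ∫⁻ t, f (Function.update x i t) ∂κ i) x := by
            rw [← lmarginal_insert f hf hi, lmarginal_insert' f hf hi]
        _ ≤ lmarginal (fun _ => γ) s (fun x => ∫⁻ t, f (Function.update x i t) ∂γ) x := by
            rw [hκ]
            simp only [κ, Function.update_self]
            exact lmarginal_mono (fun y => h i y) x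
        _ = lmarginal (fun _ => γ) (insert i s) f x := by
            rw [lmarginal_insert' f hf hi]
  rw [lintegral_eq_lmarginal_univ (μ := fun _ : ι => ρ) 0,
    lintegral_eq_lmarginal_univ (μ := fun _ : ι => γ) 0]
  exact key _ 0

lemma lintegral_rademacher {f : ℝ → ℝ≥0∞} (hf : Measurable f) :
    ∫⁻ t, f t ∂rademacher = 2⁻¹ * (f 1 + f (-1)) := by
  simp [rademacher, lintegral_dirac' _ hf, mul_add]

instance : IsProbabilityMeasure rademacher := ⟨by
  rw [← lintegral_one, lintegral_rademacher measurable_const, one_add_one_eq_two]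
  exact ENNReal.inv_mul_cancel (by simp) (by simp)⟩

lemma lintegral_exp_affine_rademacher (a b : ℝ) :
    ∫⁻ t, ENNReal.ofReal (Real.exp (a + t * b)) ∂rademacher
      = ENNReal.ofReal (Real.exp a * Real.cosh b) := by
  rw [lintegral_rademacher (by fun_prop), ← ENNReal.ofReal_add (by positivity) (by positivity),
    show (2 : ℝ≥0∞)⁻¹ = ENNReal.ofReal 2⁻¹ by
      rw [ENNReal.ofReal_inv_of_pos two_pos, ENNReal.ofReal_ofNat],
    ← ENNReal.ofReal_mul (by positivity), Real.cosh_eq, Real.exp_add, Real.exp_add]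
  congr 1
  rw [one_mul, neg_one_mul]
  ring

lemma lintegral_exp_affine_gaussian (a b : ℝ) :
    ∫⁻ t, ENNReal.ofReal (Real.exp (a + t * b)) ∂gaussianReal 0 1
      = ENNReal.ofReal (Real.exp a * Real.exp (b ^ 2 / 2)) := by
  have h := congrFun (mgf_id_gaussianReal (μ := 0) (v := 1)) b
  simp only [mgf, id] at h
  have hi : Integrable (fun t => Real.exp (a + t * b)) (gaussianReal 0 1) := by
    simp_rw [Real.exp_add, mul_comm _ b]
    exact (integrable_exp_mul_gaussianReal b).const_mul _
  rw [← ofReal_integral_eq_lintegral_ofReal hi (ae_of_all _ fun _ => (Real.exp_pos _).le)]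
  simp_rw [Real.exp_add, mul_comm _ b, integral_const_mul]
  rw [h]
  simp

lemma lintegral_exp_affine_le (a b : ℝ) :
    ∫⁻ t, ENNReal.ofReal (Real.exp (a + t * b)) ∂rademacher
      ≤ ∫⁻ t, ENNReal.ofReal (Real.exp (a + t * b)) ∂gaussianReal 0 1 := by
  rw [lintegral_exp_affine_rademacher, lintegral_exp_affine_gaussian]
  gcongr
  exact Real.cosh_le_exp_half_sq b

/-- The only quadratic term in the coordinate `i` is `B i i * t ^ 2`, which vanishes. -/
lemma exists_dotProduct_mulVec_update_eq {B : Matrix ι ι ℝ} {i : ι} (hB : B i i = 0) (x : ι → ℝ) :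
    ∃ a b : ℝ, ∀ t, Function.update x i t ⬝ᵥ B *ᵥ Function.update x i t = a + t * b := by
  set y := Function.update x i 0
  set e : ι → ℝ := Pi.single i 1
  refine ⟨y ⬝ᵥ B *ᵥ y, y ⬝ᵥ B *ᵥ e + e ⬝ᵥ B *ᵥ y, fun t => ?_⟩
  have hu : Function.update x i t = y + t • e := by
    funext j
    by_cases hj : j = i
    · subst hj; simp [y, e]
    · simp [y, e, hj]
  have he : e ⬝ᵥ B *ᵥ e = 0 := by simp [e, hB]
  rw [hu]
  simp only [Matrix.mulVec_add, Matrix.mulVec_smul, dotProduct_add, add_dotProduct,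
    dotProduct_smul, smul_dotProduct, smul_eq_mul, he]
  ring

omit [DecidableEq ι] in
lemma measurable_dotProduct_mulVec (B : Matrix ι ι ℝ) :
    Measurable fun x : ι → ℝ => x ⬝ᵥ B *ᵥ x := by
  simp only [dotProduct, Matrix.mulVec]
  fun_prop

lemma lintegral_exp_chaos_le_gaussian {B : Matrix ι ι ℝ} (hB : ∀ i, B i i = 0) :
    ∫⁻ x, ENNReal.ofReal (Real.exp (x ⬝ᵥ B *ᵥ x)) ∂Measure.pi (fun _ : ι => rademacher)
      ≤ ∫⁻ x, ENNReal.ofReal (Real.exp (x ⬝ᵥ B *ᵥ x))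
          ∂Measure.pi (fun _ : ι => gaussianReal 0 1) := by
  have := measurable_dotProduct_mulVec B
  refine lintegral_pi_le_of_update_le _ _ (by fun_prop) fun i x => ?_
  obtain ⟨a, b, h⟩ := exists_dotProduct_mulVec_update_eq (hB i) x
  simp_rw [h]
  exact lintegral_exp_affine_le a b

/-! ### Exponential moments of a Gaussian chaos -/

lemma lintegral_exp_sq_gaussian_le {b κ : ℝ} (hb : b ≤ κ) (hκ : 2 * κ < 1) :
    ∫⁻ t, ENNReal.ofReal (Real.exp (b * t ^ 2)) ∂gaussianReal 0 1
      ≤ ENNReal.ofReal (Real.exp (b + 2 * b ^ 2 / (1 - 2 * κ))) := by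
  have hb' : 0 < 1 / 2 - b := by linarith
  rw [gaussianReal_of_var_ne_zero _ one_ne_zero,
    lintegral_withDensity_eq_lintegral_mul _ (measurable_gaussianPDF 0 1) (by fun_prop)]
  have hfun : ∀ t : ℝ, (gaussianPDF 0 1 * fun t => ENNReal.ofReal (Real.exp (b * t ^ 2))) t
      = ENNReal.ofReal ((√(2 * Real.pi))⁻¹ * Real.exp (-(1 / 2 - b) * t ^ 2)) := by
    intro t
    rw [Pi.mul_apply, gaussianPDF, ← ENNReal.ofReal_mul (gaussianPDFReal_nonneg _ _ _),
      gaussianPDFReal, mul_assoc, ← Real.exp_add]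
    congr 2
    · simp
    · congr 1
      simp
      ring
  simp_rw [hfun]
  rw [← ofReal_integral_eq_lintegral_ofReal ((integrable_exp_neg_mul_sq hb').const_mul _)
    (ae_of_all _ fun _ => by positivity), integral_const_mul, integral_gaussian]
  refine ENNReal.ofReal_le_ofReal ?_
  have h1 : 0 < 1 - 2 * b := by linarith
  have h2 : (√(2 * Real.pi))⁻¹ * √(Real.pi / (1 / 2 - b)) = √((1 - 2 * b)⁻¹) := by
    rw [← Real.sqrt_inv, ← Real.sqrt_mul (by positivity)]
    congr 1
    have := Real.pi_pos.ne'
    field_simp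
  rw [h2, Real.sqrt_eq_rpow, ← Real.exp_log (inv_pos.2 h1), ← Real.exp_mul]
  refine Real.exp_le_exp.2 ?_
  -- The integral is $u^{1/2}$ with $u=(1-2b)^{-1}$. From $\log u\le u-1$ the exponent is at most
  -- $b/(1-2b)=b+2b^2/(1-2b)$; the linear term is kept apart because it cancels on summing over the
  -- eigenvalues.
  have h3 := Real.log_le_sub_one_of_pos (inv_pos.2 h1)
  have h4 : (1 - 2 * b)⁻¹ - 1 = 2 * (b + 2 * b ^ 2 / (1 - 2 * b)) := by
    field_simp
    ring
  have h5 : 2 * b ^ 2 / (1 - 2 * b) ≤ 2 * b ^ 2 / (1 - 2 * κ) := by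
    gcongr
  linarith

/-- Both sides equal $\operatorname{tr}(B^2)$. -/
lemma sum_sq_eigenvalues {B : Matrix ι ι ℝ} (hB : B.IsHermitian) :
    ∑ i, hB.eigenvalues i ^ 2 = ∑ i, ∑ j, B i j ^ 2 := by
  have h1 : (B * B).trace = ∑ i, ∑ j, B i j ^ 2 := by
    simp only [Matrix.trace, Matrix.diag, Matrix.mul_apply]
    refine Finset.sum_congr rfl fun i _ => Finset.sum_congr rfl fun j _ => ?_
    rw [show B j i = B i j by simpa using hB.apply i j, sq]
  rw [← h1]
  conv_rhs => rw [hB.spectral_theorem, ← map_mul, Unitary.conjStarAlgAut_apply,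
    Matrix.trace_mul_cycle]
  simp [Matrix.trace, sq]

lemma dotProduct_mulVec_eigenvectorBasis {B : Matrix ι ι ℝ} (hB : B.IsHermitian) (y : ι → ℝ) :
    let x : ι → ℝ := WithLp.ofLp (∑ i, y i • hB.eigenvectorBasis i)
    x ⬝ᵥ B *ᵥ x = ∑ i, hB.eigenvalues i * y i ^ 2 := by
  intro x
  have hx : x = ∑ i, y i • WithLp.ofLp (hB.eigenvectorBasis i) := by simp [x]
  have h1 : ∀ i j, WithLp.ofLp (hB.eigenvectorBasis i) ⬝ᵥ WithLp.ofLp (hB.eigenvectorBasis j)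
      = if i = j then 1 else 0 := by
    intro i j
    have := orthonormal_iff_ite.1 hB.eigenvectorBasis.orthonormal j i
    rw [EuclideanSpace.inner_eq_star_dotProduct] at this
    simpa [eq_comm] using this
  rw [hx, Matrix.mulVec_sum]
  simp only [Matrix.mulVec_smul, hB.mulVec_eigenvectorBasis, sum_dotProduct, dotProduct_sum,
    smul_dotProduct, dotProduct_smul, h1, smul_eq_mul, mul_ite, mul_one, mul_zero]
  simp
  exact Finset.sum_congr rfl fun i _ => by ring

/-- In an orthonormal eigenbasis the coordinates are again independent standard Gaussians and the
form is $\sum_i\lambda_iy_i^2$, so the integral factors into one-dimensional ones. -/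
lemma lintegral_exp_gaussian_chaos_le {B : Matrix ι ι ℝ} (hB : B.IsHermitian) (htr : B.trace = 0)
    {κ : ℝ} (hκB : ∀ x : ι → ℝ, x ⬝ᵥ B *ᵥ x ≤ κ * (x ⬝ᵥ x)) (hκ : 2 * κ < 1) :
    ∫⁻ x, ENNReal.ofReal (Real.exp (x ⬝ᵥ B *ᵥ x)) ∂Measure.pi (fun _ : ι => gaussianReal 0 1)
      ≤ ENNReal.ofReal (Real.exp (2 * (∑ i, ∑ j, B i j ^ 2) / (1 - 2 * κ))) := by
  have hle : ∀ i, hB.eigenvalues i ≤ κ := by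
    intro i
    have h := hκB (WithLp.ofLp (hB.eigenvectorBasis i))
    have h1 : WithLp.ofLp (hB.eigenvectorBasis i) ⬝ᵥ WithLp.ofLp (hB.eigenvectorBasis i) = 1 := by
      have := orthonormal_iff_ite.1 hB.eigenvectorBasis.orthonormal i i
      rw [EuclideanSpace.inner_eq_star_dotProduct] at this
      simpa using this
    rw [hB.mulVec_eigenvectorBasis, dotProduct_smul, h1] at h
    simpa using h
  have hm := measurable_dotProduct_mulVec B
  have hm' : Measurable fun x : EuclideanSpace ℝ ι =>
      ENNReal.ofReal (Real.exp (x.ofLp ⬝ᵥ B *ᵥ x.ofLp)) := by fun_prop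
  have hrot : ∫⁻ x, ENNReal.ofReal (Real.exp (x ⬝ᵥ B *ᵥ x))
        ∂Measure.pi (fun _ : ι => gaussianReal 0 1)
      = ∫⁻ y, ENNReal.ofReal (Real.exp (∑ i, hB.eigenvalues i * y i ^ 2))
        ∂Measure.pi (fun _ : ι => gaussianReal 0 1) := by
    have h1 : ∫⁻ x, ENNReal.ofReal (Real.exp (x.ofLp ⬝ᵥ B *ᵥ x.ofLp))
        ∂stdGaussian (EuclideanSpace ℝ ι) = ∫⁻ x, ENNReal.ofReal (Real.exp (x ⬝ᵥ B *ᵥ x))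
        ∂Measure.pi (fun _ : ι => gaussianReal 0 1) := by
      rw [← map_pi_eq_stdGaussian, lintegral_map hm' (by fun_prop)]
    rw [← h1, stdGaussian_eq_map_pi_orthonormalBasis hB.eigenvectorBasis,
      lintegral_map hm' (by fun_prop)]
    refine lintegral_congr fun y => ?_
    rw [dotProduct_mulVec_eigenvectorBasis hB y]
  rw [hrot]
  simp_rw [Real.exp_sum]
  simp_rw [ENNReal.ofReal_prod_of_nonneg fun _ _ => (Real.exp_pos _).le]
  rw [lintegral_prod_eq_prod_lintegral_of_indepFun Finset.univ
    (fun i (y : ι → ℝ) => ENNReal.ofReal (Real.exp (hB.eigenvalues i * y i ^ 2)))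
    (iIndepFun_pi (μ := fun _ : ι => gaussianReal 0 1)
      (X := fun i t => ENNReal.ofReal (Real.exp (hB.eigenvalues i * t ^ 2)))
      fun _ => Measurable.aemeasurable (by fun_prop)) fun _ => by fun_prop]
  have heval : ∀ i, ∫⁻ y, ENNReal.ofReal (Real.exp (hB.eigenvalues i * y i ^ 2))
        ∂Measure.pi (fun _ : ι => gaussianReal 0 1)
      = ∫⁻ t, ENNReal.ofReal (Real.exp (hB.eigenvalues i * t ^ 2)) ∂gaussianReal 0 1 := fun i =>
    (measurePreserving_eval (fun _ : ι => gaussianReal 0 1) i).lintegral_comp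
      (f := fun t => ENNReal.ofReal (Real.exp (hB.eigenvalues i * t ^ 2))) (by fun_prop)
  simp_rw [heval]
  refine (Finset.prod_le_prod' fun i _ => lintegral_exp_sq_gaussian_le (hle i) hκ).trans ?_
  rw [← ENNReal.ofReal_prod_of_nonneg fun _ _ => (Real.exp_pos _).le, ← Real.exp_sum,
    Finset.sum_add_distrib, ← Finset.sum_div, ← Finset.mul_sum, sum_sq_eigenvalues]
  have : ∑ i, hB.eigenvalues i = 0 := by
    have := hB.trace_eq_sum_eigenvalues
    simpa [htr] using this.symm
  rw [this, zero_add]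

end GaussianComparison

/-! ### Rademacher chaos of order two: variance and tails -/

section RademacherChaos

variable {ι Ω : Type*} [MeasurableSpace Ω] {μ : Measure Ω} {X : ι → Ω → ℝ}

lemma IsRademacherFamily.comp_injective (hX : IsRademacherFamily X μ) {κ : Type*} {g : κ → ι}
    (hg : g.Injective) : IsRademacherFamily (fun k => X (g k)) μ :=
  ⟨fun k => hX.hasLaw (g k), hX.indep.precomp hg⟩

lemma ae_rademacher : ∀ᵐ t ∂rademacher, t = 1 ∨ t = -1 := by
  have hm : MeasurableSet {t : ℝ | t = 1 ∨ t = -1} :=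
    (Set.toFinite ({1, -1} : Set ℝ)).measurableSet
  rw [ae_iff, rademacher, Measure.smul_apply, Measure.add_apply,
    Measure.dirac_apply' _ (by simpa [Set.compl_def] using hm.compl),
    Measure.dirac_apply' _ (by simpa [Set.compl_def] using hm.compl)]
  simp

lemma IsRademacherFamily.ae_eq_one_or [Countable ι] (hX : IsRademacherFamily X μ) :
    ∀ᵐ ω ∂μ, ∀ i, X i ω = 1 ∨ X i ω = -1 := by
  refine ae_all_iff.2 fun i => ?_
  have := ae_rademacher
  rw [← (hX.hasLaw i).map_eq] at this
  exact ae_of_ae_map (hX.hasLaw i).aemeasurable this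

lemma integral_pow_rademacher (e : ℕ) :
    ∫ t, t ^ e ∂rademacher = if Even e then 1 else 0 := by
  rw [rademacher, integral_smul_measure, integral_add_measure]
  · rw [integral_dirac, integral_dirac]
    split_ifs with h
    · rw [h.neg_one_pow]; norm_num
    · rw [(Nat.not_even_iff_odd.1 h).neg_one_pow]; norm_num
  all_goals exact integrable_dirac (by simp)

variable [Fintype ι]

/-- By independence the mixed moment factors, and an odd moment of a sign is zero. -/
lemma IsRademacherFamily.integral_prod_pow (hX : IsRademacherFamily X μ) (e : ι → ℕ) :
    ∫ ω, ∏ i, X i ω ^ e i ∂μ = if ∀ i, Even (e i) then 1 else 0 := by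
  rw [hX.indep.integral_fun_prod_comp (f := fun i t => t ^ e i)
    (fun i => (hX.hasLaw i).aemeasurable) (fun i => by fun_prop)]
  have : ∀ i, ∫ ω, X i ω ^ e i ∂μ = if Even (e i) then 1 else 0 := fun i => by
    rw [← integral_pow_rademacher]
    exact (hX.hasLaw i).integral_comp (f := fun t => t ^ e i) (by fun_prop)
  simp_rw [this]
  split_ifs with h
  · simp [h]
  · push Not at h
    obtain ⟨i, hi⟩ := h
    exact Finset.prod_eq_zero (Finset.mem_univ i) (by simpa using hi)

lemma IsRademacherFamily.integrable_prod_pow [IsFiniteMeasure μ] (hX : IsRademacherFamily X μ)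
    (e : ι → ℕ) : Integrable (fun ω => ∏ i, X i ω ^ e i) μ := by
  have hm : ∀ i, AEMeasurable (X i) μ := fun i => (hX.hasLaw i).aemeasurable
  refine Integrable.of_bound (C := 1) (by fun_prop) ?_
  filter_upwards [hX.ae_eq_one_or] with ω hω
  rw [Real.norm_eq_abs, Finset.abs_prod]
  refine (Finset.prod_eq_one fun i _ => ?_).le
  rcases hω i with h | h <;> simp [h]

variable [DecidableEq ι]

lemma prod_pow_single (x : ι → ℝ) (i : ι) : ∏ a, x a ^ (Pi.single i 1 : ι → ℕ) a = x i := by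
  simp [Pi.single_apply, pow_ite]

lemma prod_pow_single_add (x : ι → ℝ) (i j : ι) :
    ∏ a, x a ^ (Pi.single i 1 + Pi.single j 1 : ι → ℕ) a = x i * x j := by
  simp only [Pi.add_apply, pow_add, Finset.prod_mul_distrib, prod_pow_single]

lemma prod_pow_single_add_four (x : ι → ℝ) (i j k l : ι) :
    ∏ a, x a ^ (Pi.single i 1 + Pi.single j 1 + Pi.single k 1 + Pi.single l 1 : ι → ℕ) a
      = x i * x j * (x k * x l) := by
  simp only [Pi.add_apply, pow_add, Finset.prod_mul_distrib, prod_pow_single, mul_assoc]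

lemma IsRademacherFamily.integral_mul (hX : IsRademacherFamily X μ) {i j : ι} (hij : i ≠ j) :
    ∫ ω, X i ω * X j ω ∂μ = 0 := by
  have h := hX.integral_prod_pow (Pi.single i 1 + Pi.single j 1)
  simp_rw [prod_pow_single_add] at h
  rw [h, if_neg]
  intro h
  simpa [hij] using h i

lemma IsRademacherFamily.integral_mul_mul (hX : IsRademacherFamily X μ) {i j k l : ι}
    (hij : i ≠ j) (hkl : k ≠ l) :
    ∫ ω, X i ω * X j ω * (X k ω * X l ω) ∂μ
      = (if k = i ∧ l = j then 1 else 0) + if k = j ∧ l = i then 1 else 0 := by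
  have h := hX.integral_prod_pow (Pi.single i 1 + Pi.single j 1 + Pi.single k 1 + Pi.single l 1)
  simp_rw [prod_pow_single_add_four] at h
  rw [h]
  clear h
  by_cases h1 : k = i ∧ l = j
  · obtain ⟨rfl, rfl⟩ := h1
    simp only [and_self, if_true, hij, false_and, if_false, add_zero]
    rw [if_pos fun a => ?_]
    exact ⟨(Pi.single k 1 + Pi.single l 1 : ι → ℕ) a, by simp only [Pi.add_apply]; ring⟩
  by_cases h2 : k = j ∧ l = i
  · obtain ⟨rfl, rfl⟩ := h2
    simp only [and_self, if_true, hkl, false_and, if_false, zero_add]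
    rw [if_pos fun a => ?_]
    exact ⟨(Pi.single k 1 + Pi.single l 1 : ι → ℕ) a, by simp only [Pi.add_apply]; ring⟩
  rw [if_neg h1, if_neg h2, if_neg, add_zero]
  -- The exponent at `i` is 1 plus the number of `k`, `l` equal to `i`. As `k ≠ l`, evenness forces
  -- exactly one of them to be `i`, and likewise for `j`; so `(k, l)` would be one of the two
  -- excluded pairings.
  intro h
  have hi := h i
  have hj := h j
  simp only [Pi.add_apply, Pi.single_apply] at hi hj
  grind

omit [DecidableEq ι] in
lemma dotProduct_mulVec_eq_sum (B : Matrix ι ι ℝ) (x : ι → ℝ) :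
    x ⬝ᵥ B *ᵥ x = ∑ p : ι × ι, B p.1 p.2 * (x p.1 * x p.2) := by
  simp only [dotProduct, Matrix.mulVec, Finset.mul_sum, Fintype.sum_prod_type]
  exact Finset.sum_congr rfl fun i _ => Finset.sum_congr rfl fun j _ => by ring

/-- The variance of a Rademacher chaos of order two. -/
lemma IsRademacherFamily.variance_chaos [IsProbabilityMeasure μ] (hX : IsRademacherFamily X μ)
    {B : Matrix ι ι ℝ} (hB : B.IsSymm) (hd : ∀ i, B i i = 0) :
    Var[fun ω => (fun i => X i ω) ⬝ᵥ B *ᵥ (fun i => X i ω); μ] = 2 * ∑ i, ∑ j, B i j ^ 2 := by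
  have hm : ∀ i, AEMeasurable (X i) μ := fun i => (hX.hasLaw i).aemeasurable
  have hi2 : ∀ i j, Integrable (fun ω => X i ω * X j ω) μ := fun i j => by
    have := hX.integrable_prod_pow (Pi.single i 1 + Pi.single j 1)
    simpa only [prod_pow_single_add] using this
  have hi4 : ∀ i j k l, Integrable (fun ω => X i ω * X j ω * (X k ω * X l ω)) μ := fun i j k l => by
    have := hX.integrable_prod_pow (Pi.single i 1 + Pi.single j 1 + Pi.single k 1 + Pi.single l 1)
    simpa only [prod_pow_single_add_four] using this
  simp_rw [dotProduct_mulVec_eq_sum]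
  have h0 : ∫ ω, ∑ p : ι × ι, B p.1 p.2 * (X p.1 ω * X p.2 ω) ∂μ = 0 := by
    rw [integral_finsetSum _ fun p _ => (hi2 _ _).const_mul _]
    refine Finset.sum_eq_zero fun p _ => ?_
    rw [integral_const_mul]
    by_cases hp : p.1 = p.2
    · rw [hp, hd, zero_mul]
    · rw [hX.integral_mul hp, mul_zero]
  rw [variance_of_integral_eq_zero (by fun_prop) h0]
  simp_rw [sq, Finset.sum_mul_sum]
  have hre : ∀ (p q : ι × ι) ω, B p.1 p.2 * (X p.1 ω * X p.2 ω) * (B q.1 q.2 * (X q.1 ω * X q.2 ω))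
      = B p.1 p.2 * B q.1 q.2 * (X p.1 ω * X p.2 ω * (X q.1 ω * X q.2 ω)) := fun p q ω => by ring
  simp_rw [hre]
  rw [integral_finsetSum _ fun p _ => integrable_finsetSum _ fun q _ => (hi4 _ _ _ _).const_mul _]
  have hterm : ∀ p q : ι × ι,
      ∫ ω, B p.1 p.2 * B q.1 q.2 * (X p.1 ω * X p.2 ω * (X q.1 ω * X q.2 ω)) ∂μ
        = B p.1 p.2 * ((if q = p then B q.1 q.2 else 0) + if q = p.swap then B q.1 q.2 else 0) := by
    intro p q
    rw [integral_const_mul]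
    by_cases hp : p.1 = p.2
    · rw [hp, hd]; simp
    by_cases hq : q.1 = q.2
    · rw [hq, hd]; simp
    rw [hX.integral_mul_mul hp hq]
    simp only [Prod.ext_iff, Prod.fst_swap, Prod.snd_swap]
    split_ifs <;> ring
  have hsum : ∀ p : ι × ι,
      ∫ ω, ∑ q : ι × ι, B p.1 p.2 * B q.1 q.2 * (X p.1 ω * X p.2 ω * (X q.1 ω * X q.2 ω)) ∂μ
        = 2 * (B p.1 p.2 * B p.1 p.2) := by
    intro p
    rw [integral_finsetSum _ fun q _ => (hi4 _ _ _ _).const_mul _]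
    simp_rw [hterm]
    rw [← Finset.mul_sum, Finset.sum_add_distrib]
    simp only [Finset.sum_ite_eq', Finset.mem_univ, if_true, Prod.fst_swap, Prod.snd_swap]
    rw [show B p.2 p.1 = B p.1 p.2 from hB.apply _ _]
    ring
  simp_rw [hsum]
  rw [← Finset.mul_sum, Fintype.sum_prod_type]

lemma IsRademacherFamily.lintegral_exp_chaos_le [IsProbabilityMeasure μ]
    (hX : IsRademacherFamily X μ) {B : Matrix ι ι ℝ} (hB : B.IsSymm) (hd : ∀ i, B i i = 0)
    {κ : ℝ} (hκB : ∀ x : ι → ℝ, x ⬝ᵥ B *ᵥ x ≤ κ * (x ⬝ᵥ x)) (hκ : 2 * κ < 1) :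
    ∫⁻ ω, ENNReal.ofReal (Real.exp ((fun i => X i ω) ⬝ᵥ B *ᵥ (fun i => X i ω))) ∂μ
      ≤ ENNReal.ofReal (Real.exp (2 * (∑ i, ∑ j, B i j ^ 2) / (1 - 2 * κ))) := by
  have hm := measurable_dotProduct_mulVec B
  rw [(hX.indep.hasLaw_pi hX.hasLaw).lintegral_comp
    (f := fun x : ι → ℝ => ENNReal.ofReal (Real.exp (x ⬝ᵥ B *ᵥ x))) (by fun_prop)]
  refine (lintegral_exp_chaos_le_gaussian hd).trans (lintegral_exp_gaussian_chaos_le ?_ ?_ hκB hκ)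
  · rwa [Matrix.IsHermitian, Matrix.conjTranspose_eq_transpose_of_trivial]
  · simp [Matrix.trace, hd]

/-- A Bernstein-type upper tail bound for a Rademacher chaos of order two. -/
lemma IsRademacherFamily.measureReal_le_chaos_le [IsProbabilityMeasure μ]
    (hX : IsRademacherFamily X μ) {B : Matrix ι ι ℝ} (hB : B.IsSymm) (hd : ∀ i, B i i = 0)
    {κ : ℝ} (hκ0 : 0 ≤ κ) (hκB : ∀ x : ι → ℝ, x ⬝ᵥ B *ᵥ x ≤ κ * (x ⬝ᵥ x)) {ε : ℝ} (hε : 0 < ε) :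
    μ.real {ω | ε ≤ (fun i => X i ω) ⬝ᵥ B *ᵥ (fun i => X i ω)}
      ≤ Real.exp (-(ε ^ 2 / (8 * (∑ i, ∑ j, B i j ^ 2) + 8 * ε * κ))) := by
  set F := ∑ i, ∑ j, B i j ^ 2 with hF
  have hF0 : 0 ≤ F := Finset.sum_nonneg fun i _ => Finset.sum_nonneg fun j _ => sq_nonneg _
  have hεκ : 0 ≤ ε * κ := by positivity
  -- If the denominator is 0, division by zero turns the right side into $e^0=1$, a trivial bound.
  rcases (by positivity : 0 ≤ 8 * F + 8 * ε * κ).eq_or_lt with h0 | hpos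
  · rw [← h0]; simp
  -- The parameter $r=\varepsilon/D$ keeps $2r\kappa<1$ and makes the exponent $2r^2F/(1-2r\kappa)$
  -- at most half of $r\varepsilon$. What remains is $-r\varepsilon/2=-\varepsilon^2/(2D)$.
  set D := 4 * F + 4 * (ε * κ) with hD
  have hDpos : 0 < D := by rw [hD]; linarith
  set r := ε / D with hr
  have hr0 : 0 < r := by positivity
  have hrD : r * D = ε := by rw [hr]; field_simp
  have hrκ : 2 * (r * κ) < 1 := by
    have : 2 * (r * κ) = 2 * (ε * κ) / D := by rw [hr]; ring
    rw [this, div_lt_one hDpos]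
    by_contra hcon
    have h1 : ε * κ = 0 := by linarith
    have h2 : F = 0 := by linarith
    rw [hD, h1, h2] at hDpos
    simp at hDpos
  have hlap := hX.lintegral_exp_chaos_le (B := r • B) (hB.smul r) (by simp [hd]) (κ := r * κ)
    (fun x => by
      rw [Matrix.smul_mulVec, dotProduct_smul, smul_eq_mul, mul_assoc]
      exact mul_le_mul_of_nonneg_left (hκB x) hr0.le) hrκ
  have hXm : AEMeasurable (fun ω i => X i ω) μ :=
    (hX.indep.hasLaw_pi hX.hasLaw).aemeasurable
  have hcheb := mul_meas_ge_le_lintegral₀ (μ := μ)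
    (f := fun ω => ENNReal.ofReal (Real.exp ((fun i => X i ω) ⬝ᵥ (r • B) *ᵥ (fun i => X i ω))))
    ((measurable_dotProduct_mulVec (r • B)).comp_aemeasurable hXm).exp.ennreal_ofReal
    (ENNReal.ofReal (Real.exp (r * ε)))
  have hset : {ω | ENNReal.ofReal (Real.exp (r * ε)) ≤
      ENNReal.ofReal (Real.exp ((fun i => X i ω) ⬝ᵥ (r • B) *ᵥ (fun i => X i ω)))}
      = {ω | ε ≤ (fun i => X i ω) ⬝ᵥ B *ᵥ (fun i => X i ω)} := by
    ext ω
    rw [Set.mem_ofPred_eq, Set.mem_ofPred_eq, ENNReal.ofReal_le_ofReal_iff (Real.exp_pos _).le,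
      Real.exp_le_exp, Matrix.smul_mulVec, dotProduct_smul, smul_eq_mul, mul_le_mul_iff_right₀ hr0]
  rw [hset] at hcheb
  have hfin := hcheb.trans hlap
  have hreal : Real.exp (r * ε) * μ.real {ω | ε ≤ (fun i => X i ω) ⬝ᵥ B *ᵥ (fun i => X i ω)}
      ≤ Real.exp (2 * (∑ i, ∑ j, (r • B) i j ^ 2) / (1 - 2 * (r * κ))) := by
    have := ENNReal.toReal_mono ENNReal.ofReal_ne_top hfin
    rwa [ENNReal.toReal_mul, ENNReal.toReal_ofReal (Real.exp_pos _).le,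
      ENNReal.toReal_ofReal (Real.exp_pos _).le] at this
  have hFr : ∑ i, ∑ j, (r • B) i j ^ 2 = r ^ 2 * F := by
    simp [hF, Finset.mul_sum, mul_pow]
  have hexp : 2 * (r ^ 2 * F) / (1 - 2 * (r * κ)) ≤ r * ε / 2 := by
    rw [div_le_iff₀ (by linarith)]
    have : r * ε / 2 * (1 - 2 * (r * κ)) = r ^ 2 * (D / 2 - ε * κ) := by
      linear_combination (-(r / 2)) * hrD
    rw [this, hD, mul_left_comm]
    exact mul_le_mul_of_nonneg_left (by linarith) (sq_nonneg r)
  rw [hFr] at hreal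
  have hexp2 : -(ε ^ 2 / (8 * F + 8 * ε * κ)) = r * ε / 2 - r * ε := by
    rw [show 8 * F + 8 * ε * κ = 2 * D by rw [hD]; ring, hr]
    field_simp
    ring
  rw [hexp2, Real.exp_sub, le_div_iff₀ (Real.exp_pos _), mul_comm]
  exact hreal.trans (Real.exp_le_exp.2 hexp)

/-- A Bernstein-type tail bound for a Rademacher chaos of order two. -/
lemma IsRademacherFamily.measureReal_le_abs_chaos_le [IsProbabilityMeasure μ]
    (hX : IsRademacherFamily X μ) {B : Matrix ι ι ℝ} (hB : B.IsSymm) (hd : ∀ i, B i i = 0)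
    {κ : ℝ} (hκ0 : 0 ≤ κ) (hκB : ∀ x : ι → ℝ, |x ⬝ᵥ B *ᵥ x| ≤ κ * (x ⬝ᵥ x)) {ε : ℝ}
    (hε : 0 < ε) :
    μ.real {ω | ε ≤ |(fun i => X i ω) ⬝ᵥ B *ᵥ (fun i => X i ω)|}
      ≤ 2 * Real.exp (-(ε ^ 2 / (8 * (∑ i, ∑ j, B i j ^ 2) + 8 * ε * κ))) := by
  have h1 := hX.measureReal_le_chaos_le hB hd hκ0 (fun x => (le_abs_self _).trans (hκB x)) hε
  have h2 := hX.measureReal_le_chaos_le (B := -B) hB.neg (by simp [hd]) hκ0 (fun x => by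
    rw [Matrix.neg_mulVec, dotProduct_neg]
    exact (neg_le_abs _).trans (hκB x)) hε
  simp only [Matrix.neg_apply, neg_sq, Matrix.neg_mulVec, dotProduct_neg] at h2
  simp_rw [le_abs, Set.ofPred_or, two_mul]
  exact (measureReal_union_le _ _).trans (add_le_add h1 h2)

end RademacherChaos

/-! ### Norms and quadratic forms of block matrices -/

section Blocks

variable {ι κ : Type*} [Fintype ι] [DecidableEq ι] [Fintype κ] [DecidableEq κ]

omit [Fintype ι] in
lemma offDiag_apply (B : Matrix ι ι ℝ) (i j : ι) : offDiag B i j = if i = j then 0 else B i j := by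
  by_cases h : i = j
  · subst h; simp [offDiag]
  · simp [offDiag, h]

lemma dotProduct_mulVec_eq_offDiag_add_trace (B : Matrix ι ι ℝ) {x : ι → ℝ}
    (hx : ∀ i, x i = 1 ∨ x i = -1) :
    x ⬝ᵥ B *ᵥ x = x ⬝ᵥ offDiag B *ᵥ x + B.trace := by
  have hx2 : ∀ i, x i * (B i i * x i) = B i i := fun i => by
    rcases hx i with h | h <;> simp [h]
  rw [offDiag, Matrix.sub_mulVec, dotProduct_sub, Matrix.trace,
    show x ⬝ᵥ Matrix.diagonal B.diag *ᵥ x = ∑ i, B.diag i by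
      simp [dotProduct, Matrix.mulVec_diagonal, hx2]]
  ring

omit [DecidableEq ι] in
lemma frobNorm_sq (B : Matrix ι ι ℝ) : frobNorm B ^ 2 = ∑ i, ∑ j, B i j ^ 2 := by
  rw [frobNorm, Matrix.frobenius_norm_def, ← Real.sqrt_eq_rpow, Real.sq_sqrt (by positivity)]
  simp

lemma specNorm_nonneg (B : Matrix ι ι ℝ) : 0 ≤ specNorm B := norm_nonneg _

lemma abs_dotProduct_mulVec_le (B : Matrix ι ι ℝ) (x : ι → ℝ) :
    |x ⬝ᵥ B *ᵥ x| ≤ specNorm B * (x ⬝ᵥ x) := by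
  have h1 : inner ℝ (Matrix.toEuclideanCLM (n := ι) (𝕜 := ℝ) B (WithLp.toLp 2 x)) (WithLp.toLp 2 x)
      = x ⬝ᵥ B *ᵥ x := by
    rw [EuclideanSpace.inner_eq_star_dotProduct]
    simp
  have h2 : ‖(WithLp.toLp 2 x : EuclideanSpace ℝ ι)‖ * ‖(WithLp.toLp 2 x : EuclideanSpace ℝ ι)‖
      = x ⬝ᵥ x := by
    rw [← real_inner_self_eq_norm_mul_norm, EuclideanSpace.inner_eq_star_dotProduct]
    simp
  rw [← h1, ← h2, ← mul_assoc]
  refine (abs_real_inner_le_norm _ _).trans ?_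
  gcongr
  exact ContinuousLinearMap.le_opNorm _ _

lemma dotProduct_blockDiagonal'_mulVec {α : ι → Type*} [∀ i, Fintype (α i)]
    (M : ∀ i, Matrix (α i) (α i) ℝ) (x : (Σ i, α i) → ℝ) :
    x ⬝ᵥ Matrix.blockDiagonal' M *ᵥ x
      = ∑ i, (fun a => x ⟨i, a⟩) ⬝ᵥ M i *ᵥ (fun a => x ⟨i, a⟩) := by
  simp only [dotProduct, Matrix.mulVec, Fintype.sum_sigma]
  refine Finset.sum_congr rfl fun i _ => Finset.sum_congr rfl fun a _ => ?_
  rw [Finset.sum_eq_single i]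
  · simp [Matrix.blockDiagonal'_apply_eq]
  · intro j _ hj
    exact Finset.sum_eq_zero fun b _ => by rw [Matrix.blockDiagonal'_apply_ne _ _ _ hj.symm, zero_mul]
  · simp

lemma sum_sq_blockDiagonal' {α : ι → Type*} [∀ i, Fintype (α i)]
    (M : ∀ i, Matrix (α i) (α i) ℝ) :
    ∑ p, ∑ q, Matrix.blockDiagonal' M p q ^ 2 = ∑ i, ∑ a, ∑ b, M i a b ^ 2 := by
  simp only [Fintype.sum_sigma]
  refine Finset.sum_congr rfl fun i _ => Finset.sum_congr rfl fun a _ => ?_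
  rw [Finset.sum_eq_single i]
  · simp [Matrix.blockDiagonal'_apply_eq]
  · intro j _ hj
    exact Finset.sum_eq_zero fun b _ => by
      rw [Matrix.blockDiagonal'_apply_ne _ _ _ hj.symm, sq, zero_mul]
  · simp

open scoped Kronecker

omit [DecidableEq κ] in
lemma dotProduct_one_kronecker_mulVec (K : Matrix κ κ ℝ) (x : ι × κ → ℝ) :
    x ⬝ᵥ ((1 : Matrix ι ι ℝ) ⊗ₖ K) *ᵥ x
      = ∑ s, (fun a => x (s, a)) ⬝ᵥ K *ᵥ (fun a => x (s, a)) := by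
  simp only [dotProduct, Matrix.mulVec, Fintype.sum_prod_type, Matrix.kroneckerMap_apply,
    Matrix.one_apply, ite_mul, one_mul, zero_mul]
  refine Finset.sum_congr rfl fun s _ => Finset.sum_congr rfl fun a _ => ?_
  rw [Finset.sum_comm]
  simp

omit [DecidableEq κ] in
lemma sum_sq_one_kronecker (K : Matrix κ κ ℝ) :
    ∑ p, ∑ q, ((1 : Matrix ι ι ℝ) ⊗ₖ K) p q ^ 2 = Fintype.card ι * ∑ a, ∑ b, K a b ^ 2 := by
  simp only [Fintype.sum_prod_type, Matrix.kroneckerMap_apply, Matrix.one_apply, ite_mul, one_mul,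
    zero_mul, ite_pow]
  simp

end Blocks

/-! ### The probing error as a single chaos -/

section Estimator

open scoped Kronecker

variable {n m : ℕ} (M : Matrix (Fin n) (Fin n) ℝ) (col : Fin n → Fin m) (N : Fin m → ℕ)

/-- The matrix of the quadratic form in the random signs that is the error of the probing
estimator: block diagonal, with `N ℓ` copies of `(1 / N ℓ) Off([M]_{C_ℓ})`. -/
noncomputable def errorMatrix : Matrix (SignIndex col N) (SignIndex col N) ℝ :=
  Matrix.blockDiagonal' fun ℓ => (1 / (N ℓ : ℝ)) •
    ((1 : Matrix (Fin (N ℓ)) (Fin (N ℓ)) ℝ) ⊗ₖ offDiag (colorBlock M col ℓ))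

lemma dotProduct_errorMatrix_mulVec (x : SignIndex col N → ℝ) :
    x ⬝ᵥ errorMatrix M col N *ᵥ x = ∑ ℓ, (1 / (N ℓ : ℝ)) * ∑ s : Fin (N ℓ),
      (fun i => x ⟨ℓ, s, i⟩) ⬝ᵥ offDiag (colorBlock M col ℓ) *ᵥ (fun i => x ⟨ℓ, s, i⟩) := by
  simp only [errorMatrix, dotProduct_blockDiagonal'_mulVec, Matrix.smul_mulVec, dotProduct_smul,
    dotProduct_one_kronecker_mulVec, smul_eq_mul]

lemma errorMatrix_diag (k : SignIndex col N) : errorMatrix M col N k k = 0 := by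
  obtain ⟨ℓ, s, i⟩ := k
  simp [errorMatrix, Matrix.blockDiagonal'_apply_eq, offDiag_apply]

variable {M} in
lemma isSymm_offDiag_colorBlock (hM : M.IsSymm) (ℓ : Fin m) :
    (offDiag (colorBlock M col ℓ)).IsSymm := by
  refine Matrix.IsSymm.ext fun i j => ?_
  simp only [offDiag_apply, colorBlock, Matrix.submatrix_apply, hM.apply, eq_comm]

variable {M} in
lemma isSymm_errorMatrix (hM : M.IsSymm) : (errorMatrix M col N).IsSymm := by
  rw [Matrix.IsSymm, errorMatrix, Matrix.blockDiagonal'_transpose]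
  congr 1
  funext ℓ
  rw [Matrix.transpose_smul, ← Matrix.kroneckerMap_transpose, Matrix.transpose_one,
    (isSymm_offDiag_colorBlock col hM ℓ).eq]

-- The `N ℓ` copies of a block, each scaled by `1 / N ℓ`, contribute `N ℓ / (N ℓ) ^ 2 = 1 / N ℓ`
-- times its squared Frobenius norm.
variable {N} in
lemma sum_sq_errorMatrix (hN : ∀ ℓ, 0 < N ℓ) :
    ∑ p, ∑ q, errorMatrix M col N p q ^ 2 = etaOne M col N := by
  rw [errorMatrix, sum_sq_blockDiagonal', etaOne]
  refine Finset.sum_congr rfl fun ℓ _ => ?_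
  have : (N ℓ : ℝ) ≠ 0 := Nat.cast_ne_zero.2 (hN ℓ).ne'
  simp only [Matrix.smul_apply, smul_eq_mul, mul_pow, ← Finset.mul_sum]
  rw [sum_sq_one_kronecker, frobNorm_sq, Fintype.card_fin]
  field_simp

lemma etaOne_nonneg : 0 ≤ etaOne M col N :=
  Finset.sum_nonneg fun _ _ => mul_nonneg (by positivity) (sq_nonneg _)

lemma etaTwo_nonneg : 0 ≤ etaTwo M col N :=
  -- This includes `m = 0`, where the supremum over the empty family is 0.
  Real.iSup_nonneg fun _ => mul_nonneg (by positivity) (specNorm_nonneg _)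

/-- The form splits over the pairs `(ℓ, s)`. Each piece is controlled by the spectral norm of its
scaled block, hence by the maximum, and the squared lengths of the pieces add up. -/
lemma abs_dotProduct_errorMatrix_mulVec_le (x : SignIndex col N → ℝ) :
    |x ⬝ᵥ errorMatrix M col N *ᵥ x| ≤ etaTwo M col N * (x ⬝ᵥ x) := by
  have hx : x ⬝ᵥ x = ∑ ℓ, ∑ s : Fin (N ℓ), (fun i => x ⟨ℓ, s, i⟩) ⬝ᵥ (fun i => x ⟨ℓ, s, i⟩) := by
    simp only [dotProduct, Fintype.sum_sigma, Fintype.sum_prod_type]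
  rw [dotProduct_errorMatrix_mulVec, hx, Finset.mul_sum]
  refine (Finset.abs_sum_le_sum_abs _ _).trans (Finset.sum_le_sum fun ℓ _ => ?_)
  rw [abs_mul, abs_of_nonneg (by positivity : (0 : ℝ) ≤ 1 / N ℓ), Finset.mul_sum]
  refine (mul_le_mul_of_nonneg_left (Finset.abs_sum_le_sum_abs _ _) (by positivity)).trans ?_
  rw [Finset.mul_sum]
  refine Finset.sum_le_sum fun s _ => ?_
  refine (mul_le_mul_of_nonneg_left (abs_dotProduct_mulVec_le _ _) (by positivity)).trans ?_
  rw [← mul_assoc]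
  refine mul_le_mul_of_nonneg_right ?_ (Finset.sum_nonneg fun i _ => mul_self_nonneg _)
  exact le_ciSup (f := fun ℓ => (1 / (N ℓ : ℝ)) * specNorm (offDiag (colorBlock M col ℓ)))
    (Set.finite_range _).bddAbove ℓ

lemma probingForm_eq (x : SignIndex col N → ℝ) (ℓ : Fin m) (s : Fin (N ℓ)) :
    probingForm M col N x ℓ s
      = (fun i => x ⟨ℓ, s, i⟩) ⬝ᵥ colorBlock M col ℓ *ᵥ (fun i => x ⟨ℓ, s, i⟩) := by
  simp only [probingForm, probingVector, Matrix.mulVec_sum, sum_dotProduct, dotProduct_sum,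
    Matrix.mulVec_smul, smul_dotProduct, dotProduct_smul, Matrix.mulVec_single_one,
    single_one_dotProduct, smul_eq_mul, Matrix.col_apply]
  simp only [dotProduct, Matrix.mulVec, Finset.mul_sum, colorBlock, Matrix.submatrix_apply]
  rw [Finset.sum_comm]
  exact Finset.sum_congr rfl fun i _ => Finset.sum_congr rfl fun j _ => by ring

lemma sum_trace_colorBlock : ∑ ℓ, (colorBlock M col ℓ).trace = M.trace := by
  simp only [Matrix.trace, colorBlock, Matrix.diag, Matrix.submatrix_apply]
  exact Fintype.sum_fiberwise col fun i => M i i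

variable {N} in
lemma trace_sub_probingEstimator (hN : ∀ ℓ, 0 < N ℓ) {x : SignIndex col N → ℝ}
    (hx : ∀ k, x k = 1 ∨ x k = -1) :
    M.trace - probingEstimator M col N x = -(x ⬝ᵥ errorMatrix M col N *ᵥ x) := by
  have h : ∀ ℓ, (1 / (N ℓ : ℝ)) * ∑ s : Fin (N ℓ), probingForm M col N x ℓ s
      = (1 / (N ℓ : ℝ)) * ∑ s : Fin (N ℓ), (fun i => x ⟨ℓ, s, i⟩) ⬝ᵥ
        offDiag (colorBlock M col ℓ) *ᵥ (fun i => x ⟨ℓ, s, i⟩) + (colorBlock M col ℓ).trace := by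
    intro ℓ
    have : (N ℓ : ℝ) ≠ 0 := Nat.cast_ne_zero.2 (hN ℓ).ne'
    simp_rw [probingForm_eq, dotProduct_mulVec_eq_offDiag_add_trace (colorBlock M col ℓ)
      fun i => hx ⟨ℓ, _, i⟩, Finset.sum_add_distrib, mul_add]
    simp [this]
  rw [probingEstimator, dotProduct_errorMatrix_mulVec, Finset.sum_congr rfl fun ℓ _ => h ℓ,
    Finset.sum_add_distrib, sum_trace_colorBlock]
  ring

variable {Ω : Type*} [MeasurableSpace Ω] {μ : Measure Ω} [IsProbabilityMeasure μ]
  {X : SignIndex col N → Ω → ℝ}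

variable {M col N} in
lemma IsRademacherFamily.variance_probingForm (hX : IsRademacherFamily X μ) (hM : M.IsSymm)
    (ℓ : Fin m) (s : Fin (N ℓ)) :
    Var[fun ω => probingForm M col N (fun k => X k ω) ℓ s; μ]
      = 2 * frobNorm (offDiag (colorBlock M col ℓ)) ^ 2 := by
  have hY : IsRademacherFamily (fun i : ColorClass col ℓ => X ⟨ℓ, s, i⟩) μ :=
    hX.comp_injective (g := fun i => ⟨ℓ, s, i⟩) fun i j h => by simpa using h
  have hYm : AEMeasurable (fun ω (i : ColorClass col ℓ) => X ⟨ℓ, s, i⟩ ω) μ :=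
    (hY.indep.hasLaw_pi hY.hasLaw).aemeasurable
  have hae : (fun ω => probingForm M col N (fun k => X k ω) ℓ s) =ᵐ[μ]
      fun ω => (fun i => X ⟨ℓ, s, i⟩ ω) ⬝ᵥ offDiag (colorBlock M col ℓ) *ᵥ
        (fun i => X ⟨ℓ, s, i⟩ ω) + (colorBlock M col ℓ).trace := by
    filter_upwards [hY.ae_eq_one_or] with ω hω
    rw [probingForm_eq, dotProduct_mulVec_eq_offDiag_add_trace _ hω]
  have hm : AEStronglyMeasurable (fun ω => (fun i => X ⟨ℓ, s, i⟩ ω) ⬝ᵥ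
      offDiag (colorBlock M col ℓ) *ᵥ (fun i => X ⟨ℓ, s, i⟩ ω)) μ :=
    ((measurable_dotProduct_mulVec _).comp_aemeasurable hYm).aestronglyMeasurable
  rw [variance_congr hae, variance_add_const hm,
    hY.variance_chaos (isSymm_offDiag_colorBlock col hM ℓ) (by simp [offDiag_apply]), frobNorm_sq]

omit [IsProbabilityMeasure μ] in
variable {M col N} in
lemma IsRademacherFamily.measureReal_error_eq (hX : IsRademacherFamily X μ)
    (hN : ∀ ℓ, 0 < N ℓ) (ε : ℝ) :
    μ.real {ω | ε ≤ |M.trace - probingEstimator M col N (fun k => X k ω)|}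
      = μ.real {ω | ε ≤ |(fun k => X k ω) ⬝ᵥ errorMatrix M col N *ᵥ (fun k => X k ω)|} := by
  refine measureReal_congr ?_
  filter_upwards [hX.ae_eq_one_or] with ω hω
  have : |M.trace - probingEstimator M col N (fun k => X k ω)|
      = |(fun k => X k ω) ⬝ᵥ errorMatrix M col N *ᵥ (fun k => X k ω)| := by
    rw [trace_sub_probingEstimator M col hN hω, abs_neg]
  exact propext (by change ε ≤ _ ↔ ε ≤ _; rw [this])

end Estimator

end StochasticProbing

/-- `cfc f A` is the matrix function `f(A)` of the real symmetric matrix `A`. -/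
theorem mainTheorem4 {n m d : ℕ} (A : Matrix (Fin n) (Fin n) ℝ) (hA : A.IsSymm) (f : ℝ → ℝ)
    (hfA : cfc f A ≠ 0) (col : Fin n → Fin m)
    (hcol : StochasticProbing.IsDistanceColoring (StochasticProbing.matrixGraph A hA) d col)
    (N : Fin m → ℕ) (hN : ∀ ℓ, 0 < N ℓ)
    {Ω : Type*} [MeasurableSpace Ω] (μ : Measure Ω) [IsProbabilityMeasure μ]
    (X : StochasticProbing.SignIndex col N → Ω → ℝ)
    (hX : StochasticProbing.IsRademacherFamily X μ)
    (η₁ η₂ : ℝ) (hη₁ : η₁ = StochasticProbing.etaOne (cfc f A) col N)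
    (hη₂ : η₂ = StochasticProbing.etaTwo (cfc f A) col N)
    (fail : ℝ → ℝ)
    (hfail : ∀ ε, fail ε = μ.real {ω | ε ≤ |(cfc f A).trace -
      StochasticProbing.probingEstimator (cfc f A) col N (fun k => X k ω)|}) :
    -- `η₁` is half of the sum of the `V_ℓ / N_ℓ`, `V_ℓ` the variance of the quadratic form
    (∀ s : (ℓ : Fin m) → Fin (N ℓ), η₁ = (1 / 2) * ∑ ℓ : Fin m, (1 / (N ℓ : ℝ)) *
      Var[fun ω => StochasticProbing.probingForm (cfc f A) col N (fun k => X k ω) ℓ (s ℓ); μ]) ∧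
    ∀ ε : ℝ, 0 < ε →
      fail ε ≤ 2 * Real.exp (-(ε ^ 2 / (8 * η₁ + 8 * ε * η₂))) ∧
      -- the case of a zero denominator, where the bound is read as `0`
      (8 * η₁ + 8 * ε * η₂ = 0 → fail ε = 0) ∧
      ∀ δ : ℝ, 0 < δ → δ ≤ 1 → η₁ + ε * η₂ ≤ ε ^ 2 / (8 * Real.log (2 / δ)) → fail ε ≤ δ := by
  open StochasticProbing in
  have hM : (cfc f A).IsSymm := by
    have h : IsSelfAdjoint (cfc f A) := cfc_predicate f A
    rwa [IsSelfAdjoint, Matrix.star_eq_conjTranspose,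
      Matrix.conjTranspose_eq_transpose_of_trivial] at h
  generalize cfc f A = M at *
  have hη₁0 : 0 ≤ η₁ := hη₁ ▸ etaOne_nonneg M col N
  have hη₂0 : 0 ≤ η₂ := hη₂ ▸ etaTwo_nonneg M col N
  have hfail' := fun ε => (hfail ε).trans (hX.measureReal_error_eq hN ε)
  refine ⟨fun s => ?_, fun ε hε => ?_⟩
  · simp_rw [hX.variance_probingForm hM]
    rw [hη₁, etaOne, Finset.mul_sum]
    exact Finset.sum_congr rfl fun ℓ _ => by ring
  have hD0 : 0 ≤ 8 * η₁ + 8 * ε * η₂ := by positivity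
  have hbound : fail ε ≤ 2 * Real.exp (-(ε ^ 2 / (8 * η₁ + 8 * ε * η₂))) := by
    rw [hfail' ε, hη₁, ← sum_sq_errorMatrix M col hN, hη₂]
    exact hX.measureReal_le_abs_chaos_le (isSymm_errorMatrix col N hM) (errorMatrix_diag M col N)
      (etaTwo_nonneg M col N) (abs_dotProduct_errorMatrix_mulVec_le M col N) hε
  -- `hbound` only gives 2 here. Instead, $\eta_1=0$ forces the error matrix to vanish, so the error
  -- is almost surely zero.
  have hzero : 8 * η₁ + 8 * ε * η₂ = 0 → fail ε = 0 := by
    intro h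
    have h1 : ∑ p, ∑ q, errorMatrix M col N p q ^ 2 = 0 := by
      rw [sum_sq_errorMatrix M col hN, ← hη₁]
      have : 0 ≤ 8 * ε * η₂ := by positivity
      linarith
    have h2 : errorMatrix M col N = 0 := by
      ext p q
      have hp := (Finset.sum_eq_zero_iff_of_nonneg fun p _ =>
        Finset.sum_nonneg fun q _ => sq_nonneg _).1 h1 p (Finset.mem_univ p)
      have hq := (Finset.sum_eq_zero_iff_of_nonneg fun q _ => sq_nonneg _).1 hp q
        (Finset.mem_univ q)
      simpa using hq
    rw [hfail' ε, h2]
    simp [not_le.2 hε]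
  refine ⟨hbound, hzero, fun δ hδ hδ1 h => ?_⟩
  rcases hD0.eq_or_lt with h0 | hpos
  · rw [hzero h0.symm]
    exact hδ.le
  have hlog : 0 < Real.log (2 / δ) := Real.log_pos (by rw [lt_div_iff₀ hδ]; linarith)
  have hle : Real.log (2 / δ) ≤ ε ^ 2 / (8 * η₁ + 8 * ε * η₂) := by
    rw [le_div_iff₀ (by positivity)] at h ⊢
    linarith
  calc fail ε ≤ 2 * Real.exp (-(ε ^ 2 / (8 * η₁ + 8 * ε * η₂))) := hbound
    _ ≤ 2 * Real.exp (-Real.log (2 / δ)) := by gcongr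
    _ = δ := by
      rw [Real.exp_neg, Real.exp_log (by positivity)]
      field_simp
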